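/- **Formulae.** Consider the formulae of linear logic without propositional variables $$A,B ::= 0 \mid 1 \mid A\otimes B \mid A\oplus B \mid {?}A \mid \top \mid \bot \mid A ⅋ B \mid A \mathbin{\&} B \mid {!}A,$$ the first five forms being positive and the last five negative, with linear negation $A^\perp$ given by De Morgan duality ($0/\top$, $1/\bot$, $\otimes/⅋$, $\oplus/\&$, $?/!$). Put $\otimes^0A=1$, $\otimes^{n+1}A=(\otimes^nA)\otimes A$, $⅋^0A=\bot$, $⅋^{n+1}A=(⅋^nA)⅋A$. **Game.** A *position* is a finite tree with a selected vertex (which *holds the token*), each vertex being signed as proponent or opponent, and each edge being directed and labelled with a positive formula. An edge labelled with a negative formula denotes the reversed edge labelled with the dual formula. The vertex $v$ holding the token can make the following *moves* (up to isomorphism; the sign of a vertex is inherited, and after the move the token is at the other end $v'$ of the edge acted upon): - along an edge $v'\to v$: pass the token to $v'$, the tree being unchanged; - if an edge $v\to v'$ labelled $1$ is the only edge at $v$: delete $v$ and this edge; - on an edge $v\to v'$ labelled $A\oplus B$: relabel it $A$, or relabel it $B$; - on an edge $v\to v'$ labelled ${?}A^\perp$: for some $n\ge 0$, replace it by an edge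 $v'\to v$ labelled $\otimes^nA$; - on an edge $v\to v'$ labelled $A\otimes B$: distribute the other subtrees at $v$ into three families $\Gamma,\Gamma',{?}\Theta$, where those in ${?}\Theta$ are all attached by edges going out of $v$ with labels of the form ${?}C$; replace $v$ by two vertices $v_1,v_2$, with edges $v_1\to v'$ labelled $A$ and $v_2\to v'$ labelled $B$, where $v_1$ receives $\Gamma$ and a copy of ${?}\Theta$, and $v_2$ receives $\Gamma'$ and a second copy of ${?}\Theta$. A *play* from a position is a finite sequence of successive moves from it. A *strategy* on a position is a set of plays from it that contains the empty play, is closed under prefixes, is closed under isomorphism of plays, and contains, with each play at whose end an opponent holds the token, every extension of that play by one move. It is *winning* if an opponent holds the token at the end of each play of the strategy that has no proper extension in the strategy. A formula $A$ is *GLLTN-valid* if there is a finite tree $U$ (directed and labelled as above, with a chosen vertex $l$) such that for every finite tree $V$ (of the same kind, with a chosen vertex $r$), in the tree obtained by joining $U$ and $V$ by an edge $l\to r$ labelled $A$, with the vertices of $U$ as proponents and those of $V$ as opponents, there is a winning strategy for every initial placement of the token. **Calculus.** LLTN is the sequent calculus, on lists of formulae, whose proofs are the (possibly infinitely branching) trees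 with all branches finite built from the rules $$\frac{}{1}\quad \frac{\Gamma}{\Gamma,\bot}\quad \frac{}{\Gamma,\top}\quad \frac{\Gamma,{?}\Theta,A\quad \Delta,{?}\Theta,B}{\Gamma,\Delta,{?}\Theta,A\otimes B}\quad \frac{\Gamma,A,B}{\Gamma,A⅋B}\quad \frac{\Gamma,A}{\Gamma,A\oplus B}\quad \frac{\Gamma,B}{\Gamma,A\oplus B}\quad \frac{\Gamma,A\quad\Gamma,B}{\Gamma,A\mathbin{\&}B}$$ $$\frac{\Gamma,⅋^nA}{\Gamma,{?}A}\ (n\ge0)\quad \frac{\Gamma,\otimes^nA\ \text{ for all } n\ge 0}{\Gamma,{!}A}\quad \frac{\Gamma,B,A,\Delta}{\Gamma,A,B,\Delta}\quad \frac{\Gamma,A\quad \Delta,A^\perp}{\Gamma,\Delta}.$$ **Theorem.** For no formula $A$ are both $A$ and $A^\perp$ GLLTN-valid. Moreover, LLTN is consistent: for no formula $A$ are both $A$ and $A^\perp$ provable in LLTN. -/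

import Mathlib

namespace GLLTN

/-! ## Formulae -/

/-- Formulae of linear logic without propositional variables.  The first five are positive,
the last five are negative. -/
inductive Formula : Type
  | zero : Formula
  | one : Formula
  | tensor : Formula → Formula → Formula
  | plus : Formula → Formula → Formula
  | whynot : Formula → Formula
  | top : Formula
  | bot : Formula
  | par : Formula → Formula → Formula
  | wth : Formula → Formula → Formula
  | bang : Formula → Formula

/-- De Morgan duality (linear negation). -/
def Formula.dual : Formula → Formula
  | .zero => .top
  | .one => .bot
  | .tensor A B => .par A.dual B.dual
  | .plus A B => .wth A.dual B.dual
  | .whynot A => .bang A.dual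
  | .top => .zero
  | .bot => .one
  | .par A B => .tensor A.dual B.dual
  | .wth A B => .plus A.dual B.dual
  | .bang A => .whynot A.dual

/-- The negative formulae: `⊤`, `⊥`, `A ⅋ B`, `A & B`, `!A`. -/
def Formula.IsNegative : Formula → Prop
  | .zero | .one | .tensor _ _ | .plus _ _ | .whynot _ => False
  | .top | .bot | .par _ _ | .wth _ _ | .bang _ => True

/-- `⊗⁰ A = 1` and `⊗ⁿ⁺¹ A = (⊗ⁿ A) ⊗ A`. -/
def Formula.tensorPow (A : Formula) : ℕ → Formula
  | 0 => .one
  | n + 1 => .tensor (A.tensorPow n) A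

/-- `⅋⁰ A = ⊥` and `⅋ⁿ⁺¹ A = (⅋ⁿ A) ⅋ A`. -/
def Formula.parPow (A : Formula) : ℕ → Formula
  | 0 => .bot
  | n + 1 => .par (A.parPow n) A

/-! ## The sequent calculus -/

/-- Provability in the infinitary sequent calculus (with cut).  Sequents are lists of formulae;
being an inductive predicate, it speaks of derivation trees all of whose branches are finite. -/
inductive Provable : List Formula → Prop
  | one : Provable [.one]
  | bot (Γ : List Formula) : Provable Γ → Provable (Γ ++ [.bot])
  | top (Γ : List Formula) : Provable (Γ ++ [.top])
  | tensor (Γ Δ Θ : List Formula) (A B : Formula) :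
      Provable (Γ ++ Θ.map Formula.whynot ++ [A]) →
      Provable (Δ ++ Θ.map Formula.whynot ++ [B]) →
      Provable (Γ ++ Δ ++ Θ.map Formula.whynot ++ [.tensor A B])
  | par (Γ : List Formula) (A B : Formula) :
      Provable (Γ ++ [A, B]) → Provable (Γ ++ [.par A B])
  | plusLeft (Γ : List Formula) (A B : Formula) :
      Provable (Γ ++ [A]) → Provable (Γ ++ [.plus A B])
  | plusRight (Γ : List Formula) (A B : Formula) :
      Provable (Γ ++ [B]) → Provable (Γ ++ [.plus A B])
  | wth (Γ : List Formula) (A B : Formula) :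
      Provable (Γ ++ [A]) → Provable (Γ ++ [B]) → Provable (Γ ++ [.wth A B])
  | whynot (Γ : List Formula) (A : Formula) (n : ℕ) :
      Provable (Γ ++ [A.parPow n]) → Provable (Γ ++ [.whynot A])
  | bang (Γ : List Formula) (A : Formula) :
      (∀ n : ℕ, Provable (Γ ++ [A.tensorPow n])) → Provable (Γ ++ [.bang A])
  | exchange (Γ Δ : List Formula) (A B : Formula) :
      Provable (Γ ++ [B, A] ++ Δ) → Provable (Γ ++ [A, B] ++ Δ)
  | cut (Γ Δ : List Formula) (A : Formula) :
      Provable (Γ ++ [A]) → Provable (Δ ++ [A.dual]) → Provable (Γ ++ Δ)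

/-! ## Positions -/

/-- The sign of a vertex. -/
inductive Player : Type
  | proponent : Player
  | opponent : Player

/-- A finite punctured, directed, signed, normally labelled tree, unfolded from its selected
vertex: the sign of that vertex, and for each adjacent edge the formula by which the vertex sees
it, together with the subtree at its other end (punctured there).

An entry `(A, t)` with `A` positive is an edge labelled `A` going from the vertex to the root of
`t` (an output); an entry `(A, t)` with `A` negative is an edge labelled with the positive formula
`A.dual` going from the root of `t` to the vertex (an input).  In other words it is the
normalisation of the edge labelled `A` from the vertex to the root of `t`.  Thus the list of the
first components is the sequent of the selected vertex.  The order of the list is irrelevant, see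
`Iso`. -/
inductive Position : Type
  | node (s : Player) (cs : List (Formula × Position)) : Position

/-- The sign of the vertex that holds the token (the selected vertex). -/
def Position.holder : Position → Player
  | .node s _ => s

/-- Isomorphism of positions: the relation generated by permuting the edges adjacent to a vertex
and replacing a subtree by an isomorphic one. -/
inductive Iso : Position → Position → Prop
  | refl (t : Position) : Iso t t
  | symm {t u : Position} : Iso t u → Iso u t
  | trans {t u w : Position} : Iso t u → Iso u w → Iso t w
  | perm (s : Player) {cs ds : List (Formula × Position)} :
      cs.Perm ds → Iso (.node s cs) (.node s ds)
  | congr (s : Player) (A : Formula) {t u : Position} (cs : List (Formula × Position)) :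
      Iso t u → Iso (.node s ((A, t) :: cs)) (.node s ((A, u) :: cs))

/-! ## Moves -/

/-- The moves, drawn with the broken edge first among the edges of the active vertex.  The active
vertex has sign `s`, the passive one has sign `s'` and further edges `Δ`.  Note that an edge with
label `A` from a vertex to the passive vertex is seen by the latter as `A.dual`. -/
inductive BasicMove : Position → Position → Prop
  /-- Pass the token along an input edge, leaving the tree unchanged. -/
  | negative (s s' : Player) (Γ Δ : List (Formula × Position)) (A : Formula) :
      A.IsNegative →
      BasicMove (.node s ((A, .node s' Δ) :: Γ)) (.node s' ((A.dual, .node s Γ) :: Δ))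
  /-- A vertex whose sole adjacent edge is an output `1` passes the token along it and is deleted
  together with the edge. -/
  | one (s s' : Player) (Δ : List (Formula × Position)) :
      BasicMove (.node s [(.one, .node s' Δ)]) (.node s' Δ)
  /-- Break an output `A ⊗ B`: the active vertex is split in two; the subtrees `Θ`, all attached by
  outputs of the form `?C`, are copied. -/
  | tensor (s s' : Player) (Γ Γ' Θ Δ : List (Formula × Position)) (A B : Formula) :
      (∀ c ∈ Θ, ∃ C : Formula, c.1 = .whynot C) →
      BasicMove (.node s ((.tensor A B, .node s' Δ) :: (Γ ++ Θ ++ Γ')))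
        (.node s' ((A.dual, .node s (Γ ++ Θ)) :: (B.dual, .node s (Θ ++ Γ')) :: Δ))
  | plusLeft (s s' : Player) (Γ Δ : List (Formula × Position)) (A B : Formula) :
      BasicMove (.node s ((.plus A B, .node s' Δ) :: Γ)) (.node s' ((A.dual, .node s Γ) :: Δ))
  | plusRight (s s' : Player) (Γ Δ : List (Formula × Position)) (A B : Formula) :
      BasicMove (.node s ((.plus A B, .node s' Δ) :: Γ)) (.node s' ((B.dual, .node s Γ) :: Δ))
  /-- Replace an output `?C` by an input `⊗ⁿ C.dual`. -/
  | whynot (s s' : Player) (Γ Δ : List (Formula × Position)) (C : Formula) (n : ℕ) :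
      BasicMove (.node s ((.whynot C, .node s' Δ) :: Γ))
        (.node s' ((C.dual.tensorPow n, .node s Γ) :: Δ))

/-- Moves between positions: basic moves up to isomorphism of the source and of the target. -/
def Move (p q : Position) : Prop :=
  ∃ p' q' : Position, Iso p p' ∧ BasicMove p' q' ∧ Iso q' q

/-! ## Plays, strategies, validity -/

/-- `π` lists the positions, after the initial one, of a play from `p`. -/
def IsPlay (p : Position) (π : List Position) : Prop :=
  List.IsChain Move (p :: π)

/-- The last position of the play `π` from `p`. -/
def final (p : Position) (π : List Position) : Position :=
  π.getLastD p

/-- Strategies on the position `p`: sets of plays from `p` that contain the empty play, are closed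
under prefixes, welcoming (every move of an opponent is accepted) and stable under isomorphism
of plays. -/
structure IsStrategy (p : Position) (S : Set (List Position)) : Prop where
  isPlay : ∀ π ∈ S, IsPlay p π
  nil_mem : [] ∈ S
  mem_of_isPrefix : ∀ π ∈ S, ∀ π' : List Position, π' <+: π → π' ∈ S
  welcoming : ∀ π ∈ S, (final p π).holder = Player.opponent →
    ∀ q : Position, Move (final p π) q → π ++ [q] ∈ S
  stable : ∀ π ∈ S, ∀ π' : List Position, IsPlay p π' → List.Forall₂ Iso π π' → π' ∈ S

/-- A play of `S` is maximal when `S` contains no proper extension of it. -/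
def IsMaximalIn (S : Set (List Position)) (π : List Position) : Prop :=
  π ∈ S ∧ ∀ π' ∈ S, π <+: π' → π' = π

/-- A strategy is winning when at the end of each of its maximal plays an opponent holds the
token. -/
def IsWinningStrategy (p : Position) (S : Set (List Position)) : Prop :=
  IsStrategy p S ∧ ∀ π : List Position, IsMaximalIn S π → (final p π).holder = Player.opponent

/-- All vertices of the tree have sign `s`. -/
inductive AllSigned (s : Player) : Position → Prop
  | node (cs : List (Formula × Position)) :
      (∀ c ∈ cs, AllSigned s c.2) → AllSigned s (.node s cs)

/-- The tree made of `U`, `V` and an edge labelled `A` from the selected vertex of `U` to the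
selected vertex of `V`, with the token on the selected vertex of `U`. -/
def connect : Position → Formula → Position → Position
  | .node s cs, A, V => .node s ((A, V) :: cs)

/-- Displace the token to an adjacent vertex of the same tree, in whatever direction the edge
goes.  (This is not a move of the game.) -/
inductive Displace : Position → Position → Prop
  | step (s s' : Player) (Γ Γ' Δ : List (Formula × Position)) (A : Formula) :
      Displace (.node s (Γ ++ (A, .node s' Δ) :: Γ'))
        (.node s' ((A.dual, .node s (Γ ++ Γ')) :: Δ))

/-- `q` is the same tree as `p`, with the token placed at an arbitrary vertex. -/
def SameTree (p q : Position) : Prop :=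
  Relation.ReflTransGen Displace p q

/-- Validity: there is a tree `U` of proponents such that for every tree `V` of opponents, the
proponents have a winning strategy on `U` connected to `V` by an edge labelled `A`, wherever the
token is placed initially. -/
def Valid (A : Formula) : Prop :=
  ∃ U : Position, AllSigned Player.proponent U ∧
    ∀ V : Position, AllSigned Player.opponent V →
      ∀ p : Position, SameTree (connect U A V) p →
        ∃ S : Set (List Position), IsWinningStrategy p S

end GLLTN

/-!
Reading `!` and `?` as the identity and the other connectives classically, every provable sequent
contains a true formula, whereas `A` and `A.dual` are never both true: this gives consistency.

For validity, let the trees witnessing that `A` and `A.dual` are valid be each other's adversaries.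
Both parties then have a winning strategy on the same position, so every play that follows both
strategies can be continued. This is absurd, because all plays terminate. Termination is proved with
a reducibility predicate `Reducible A t`, defined by recursion on `A`: whatever the active vertex
does to an edge that it sees as `A` and whose other end is the root of `t`, the play from there
terminates as soon as the pieces left behind are reducible. A vertex with reducible subtrees only
is then terminating, by induction on its sequent in the multiset order.
-/

namespace GLLTN

theorem isDershowitzMannaLT_add_cons {α : Type*} [Preorder α] {X Y Z : Multiset α} {a : α}
    (hX : X ≤ Z) (hY : ∀ y ∈ Y, y < a) : (Y + X).IsDershowitzMannaLT (a ::ₘ Z) := by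
  obtain ⟨W, rfl⟩ := Multiset.le_iff_exists_add.1 hX
  exact ⟨X, Y, a ::ₘ W, Multiset.cons_ne_zero, add_comm Y X, (Multiset.add_cons a X W).symm,
    fun y hy => ⟨a, Multiset.mem_cons_self a W, hY y hy⟩⟩

namespace Formula

@[simp]
theorem dual_dual (A : Formula) : A.dual.dual = A := by
  induction A <;> simp_all [dual]

@[simp]
theorem isNegative_dual_iff {A : Formula} : A.dual.IsNegative ↔ ¬A.IsNegative := by
  cases A <;> simp [dual, IsNegative]

/-- Classical truth of a formula, the exponentials being read as the identity. -/
def Holds : Formula → Prop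
  | zero => False
  | one => True
  | tensor A B => A.Holds ∧ B.Holds
  | plus A B => A.Holds ∨ B.Holds
  | whynot A => A.Holds
  | top => True
  | bot => False
  | par A B => A.Holds ∨ B.Holds
  | wth A B => A.Holds ∧ B.Holds
  | bang A => A.Holds

theorem holds_dual_iff {A : Formula} : A.dual.Holds ↔ ¬A.Holds := by
  induction A <;> simp_all [dual, Holds, imp_iff_not_or]

theorem holds_tensorPow_iff {A : Formula} {n : ℕ} : (A.tensorPow n).Holds ↔ n = 0 ∨ A.Holds := by
  induction n <;> simp_all [tensorPow, Holds]

theorem holds_parPow_iff {A : Formula} {n : ℕ} : (A.parPow n).Holds ↔ n ≠ 0 ∧ A.Holds := by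
  induction n <;> simp_all [parPow, Holds]

end Formula

/-- Classical truth of a sequent, that is, of the disjunction of its formulae. -/
def SequentHolds (Γ : List Formula) : Prop :=
  ∃ A ∈ Γ, A.Holds

theorem not_sequentHolds_nil : ¬SequentHolds [] := by
  simp [SequentHolds]

theorem sequentHolds_cons_iff {A : Formula} {Γ : List Formula} :
    SequentHolds (A :: Γ) ↔ A.Holds ∨ SequentHolds Γ := by
  simp [SequentHolds]

theorem sequentHolds_append_iff {Γ Δ : List Formula} :
    SequentHolds (Γ ++ Δ) ↔ SequentHolds Γ ∨ SequentHolds Δ := by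
  simp [SequentHolds, or_and_right, exists_or]

theorem Provable.sequentHolds {Γ : List Formula} (h : Provable Γ) : SequentHolds Γ := by
  induction h with
  | bang Γ A _ ih =>
    have ih₁ := ih 1
    simp only [sequentHolds_append_iff, sequentHolds_cons_iff, Formula.holds_tensorPow_iff,
      one_ne_zero, false_or] at ih₁
    simpa only [sequentHolds_append_iff, sequentHolds_cons_iff, Formula.Holds] using ih₁
  | _ =>
    simp only [sequentHolds_append_iff, sequentHolds_cons_iff, not_sequentHolds_nil, Formula.Holds,
      Formula.holds_parPow_iff, Formula.holds_dual_iff] at *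
    tauto

theorem not_provable_and_provable_dual (A : Formula) : ¬(Provable [A] ∧ Provable [A.dual]) := by
  rintro ⟨h, h'⟩
  have hA : A.Holds := by simpa [SequentHolds] using h.sequentHolds
  have hA' : A.dual.Holds := by simpa [SequentHolds] using h'.sequentHolds
  exact Formula.holds_dual_iff.1 hA' hA

namespace Formula

/-- `A.Residuals L`: acting on an edge that the active vertex sees as `A` may leave the passive
vertex with the edges that it sees as the members of `L` instead. Passing the token along an input
is included, so that one predicate accounts for all moves. -/
inductive Residuals : Formula → List Formula → Prop
  | negative {A : Formula} : A.IsNegative → Residuals A [A.dual]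
  | one : Residuals .one []
  | tensor (A B : Formula) : Residuals (.tensor A B) [A.dual, B.dual]
  | plusLeft (A B : Formula) : Residuals (.plus A B) [A.dual]
  | plusRight (A B : Formula) : Residuals (.plus A B) [B.dual]
  | whynot (C : Formula) (n : ℕ) : Residuals (.whynot C) [C.dual.tensorPow n]

/-- `B.ResidualOf A`: acting on an edge seen as `A` may create an edge seen as `B`. -/
def ResidualOf (B A : Formula) : Prop :=
  ∃ L, A.Residuals L ∧ B ∈ L

theorem IsNegative.eq_dual_of_residualOf {A B : Formula} (hA : A.IsNegative)
    (hB : B.ResidualOf A) : B = A.dual := by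
  obtain ⟨L, hL, hBL⟩ := hB
  cases hL with
  | negative => exact List.mem_singleton.1 hBL
  | _ => exact hA.elim

theorem acc_dual {A : Formula} (h : Acc ResidualOf A) : Acc ResidualOf A.dual := by
  by_cases hA : A.IsNegative
  · exact h.inv ⟨_, .negative hA, List.mem_singleton_self _⟩
  · refine Acc.intro _ fun B hB => ?_
    rwa [(isNegative_dual_iff.2 hA).eq_dual_of_residualOf hB, dual_dual]

theorem acc_dual_iff {A : Formula} : Acc ResidualOf A.dual ↔ Acc ResidualOf A :=
  ⟨fun h => A.dual_dual ▸ acc_dual h, acc_dual⟩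

theorem acc_zero : Acc ResidualOf zero := by
  refine Acc.intro _ ?_
  rintro D ⟨L, hL, -⟩
  cases hL with
  | negative h => exact h.elim

theorem acc_one : Acc ResidualOf one := by
  refine Acc.intro _ ?_
  rintro D ⟨L, hL, hD⟩
  cases hL with
  | negative h => exact h.elim
  | one => exact absurd hD List.not_mem_nil

theorem acc_tensor {A B : Formula} (hA : Acc ResidualOf A) (hB : Acc ResidualOf B) :
    Acc ResidualOf (tensor A B) := by
  refine Acc.intro _ ?_
  rintro D ⟨L, hL, hD⟩
  cases hL with
  | negative h => exact h.elim
  | tensor =>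
    rcases List.mem_pair.1 hD with rfl | rfl
    exacts [acc_dual hA, acc_dual hB]

theorem acc_plus {A B : Formula} (hA : Acc ResidualOf A) (hB : Acc ResidualOf B) :
    Acc ResidualOf (plus A B) := by
  refine Acc.intro _ ?_
  rintro D ⟨L, hL, hD⟩
  cases hL with
  | negative h => exact h.elim
  | plusLeft => exact List.mem_singleton.1 hD ▸ acc_dual hA
  | plusRight => exact List.mem_singleton.1 hD ▸ acc_dual hB

theorem acc_tensorPow {A : Formula} (h : Acc ResidualOf A) (n : ℕ) :
    Acc ResidualOf (A.tensorPow n) := by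
  induction n with
  | zero => exact acc_one
  | succ n ih => exact acc_tensor ih h

theorem acc_whynot {A : Formula} (h : Acc ResidualOf A) : Acc ResidualOf (whynot A) := by
  refine Acc.intro _ ?_
  rintro D ⟨L, hL, hD⟩
  cases hL with
  | negative h => exact h.elim
  | whynot _ n => exact List.mem_singleton.1 hD ▸ acc_tensorPow (acc_dual h) n

theorem acc_residualOf (A : Formula) : Acc ResidualOf A := by
  induction A with
  | zero => exact acc_zero
  | one => exact acc_one
  | tensor A B hA hB => exact acc_tensor hA hB
  | plus A B hA hB => exact acc_plus hA hB
  | whynot A hA => exact acc_whynot hA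
  | top => exact acc_dual acc_zero
  | bot => exact acc_dual acc_one
  | par A B hA hB => exact acc_dual_iff.1 (acc_tensor (acc_dual hA) (acc_dual hB))
  | wth A B hA hB => exact acc_dual_iff.1 (acc_plus (acc_dual hA) (acc_dual hB))
  | bang A hA => exact acc_dual_iff.1 (acc_whynot (acc_dual hA))

/-- The ordinal height of a formula in the well-founded relation `ResidualOf`. -/
noncomputable def rank (A : Formula) : Ordinal.{0} :=
  A.acc_residualOf.rank

theorem ResidualOf.rank_lt {A B : Formula} (h : B.ResidualOf A) : B.rank < A.rank :=
  Acc.rank_lt_of_rel A.acc_residualOf h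

end Formula

namespace Position

theorem sizeOf_lt_of_mem {s : Player} {c : Formula × Position} {cs : List (Formula × Position)}
    (hc : c ∈ cs) : sizeOf c.2 < sizeOf (node s cs) := by
  have hcs := List.sizeOf_lt_of_mem hc
  have hc₂ : sizeOf c = 1 + sizeOf c.1 + sizeOf c.2 := rfl
  rw [node.sizeOf_spec]
  omega

@[elab_as_elim, induction_eliminator]
theorem induction {motive : Position → Prop}
    (node : ∀ s cs, (∀ c ∈ cs, motive c.2) → motive (node s cs)) (t : Position) : motive t :=
  match t with
  | .node s cs => node s cs fun c _ => induction node c.2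
termination_by t
decreasing_by exact sizeOf_lt_of_mem ‹_›

/-- The edges adjacent to the selected vertex. -/
def edges : Position → List (Formula × Position)
  | node _ cs => cs

/-- Add edges at the selected vertex. -/
def addEdges (cs : List (Formula × Position)) : Position → Position
  | node s ds => node s (cs ++ ds)

theorem edges_addEdges (cs : List (Formula × Position)) (t : Position) :
    (t.addEdges cs).edges = cs ++ t.edges := by
  cases t
  rfl

end Position

theorem Iso.addEdges {t u : Position} (h : Iso t u) (cs : List (Formula × Position)) :
    Iso (t.addEdges cs) (u.addEdges cs) := by
  induction h with
  | refl t => exact .refl _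
  | symm _ ih => exact ih.symm
  | trans _ _ ih₁ ih₂ => exact ih₁.trans ih₂
  | perm s h => exact .perm s (h.append_left cs)
  | congr s A ds h =>
    exact ((Iso.perm s List.perm_middle).trans (.congr s A (cs ++ ds) h)).trans
      (.perm s List.perm_middle.symm)

theorem Iso.map_edges_perm {α : Type*} {f : Formula × Position → α}
    (hf : ∀ A t u, Iso t u → f (A, t) = f (A, u)) {t u : Position} (h : Iso t u) :
    (t.edges.map f).Perm (u.edges.map f) := by
  induction h with
  | refl t => exact .refl _
  | symm _ ih => exact ih.symm
  | trans _ _ ih₁ ih₂ => exact ih₁.trans ih₂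
  | perm _ h => exact h.map f
  | congr s A cs h => simp [Position.edges, hf A _ _ h]

/-- Only finite plays start at the position `p`. -/
def Terminating (p : Position) : Prop :=
  Acc (fun q p => Move p q) p

theorem Terminating.of_iso {p q : Position} (h : Terminating p) (hpq : Iso p q) :
    Terminating q :=
  Acc.intro q fun _ ⟨p', q', h₁, h₂, h₃⟩ => h.inv ⟨p', q', hpq.trans h₁, h₂, h₃⟩

/-- The reducibility predicate of the termination proof: whatever happens to an edge which is seen
as `A` and whose other end is the root of `t`, the play terminates if the subtrees which `t` then
receives are themselves reducible. -/
def Reducible (A : Formula) (t : Position) : Prop :=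
  ∀ cs : List (Formula × Position), A.Residuals (cs.map Prod.fst) →
    (∀ c ∈ cs, Reducible c.1 c.2) → Terminating (t.addEdges cs)
termination_by A.rank
decreasing_by exact Formula.ResidualOf.rank_lt ⟨_, ‹_›, List.mem_map_of_mem ‹_›⟩

theorem Reducible.of_iso {A : Formula} {t u : Position} (h : Reducible A t) (htu : Iso t u) :
    Reducible A u := by
  rw [Reducible] at h ⊢
  exact fun cs hcs hred => (h cs hcs hred).of_iso (htu.addEdges cs)

namespace Position

/-- All subtrees at the selected vertex are reducible. -/
def ReducibleEdges (p : Position) : Prop :=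
  ∀ c ∈ p.edges, Reducible c.1 c.2

/-- The multiset of the ranks of the formulae of the sequent of the selected vertex. -/
noncomputable def ranks (p : Position) : Multiset Ordinal.{0} :=
  (p.edges.map fun c => c.1.rank : List Ordinal.{0})

theorem ReducibleEdges.addEdges {t : Position} {cs : List (Formula × Position)}
    (ht : t.ReducibleEdges) (hcs : ∀ c ∈ cs, Reducible c.1 c.2) :
    (t.addEdges cs).ReducibleEdges := by
  rw [ReducibleEdges, edges_addEdges]
  exact List.forall_mem_append.2 ⟨hcs, ht⟩

theorem ReducibleEdges.of_iso {p q : Position} (hp : p.ReducibleEdges) (h : Iso p q) :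
    q.ReducibleEdges := by
  have hperm := h.map_edges_perm (f := fun c => Reducible c.1 c.2)
    fun A t u htu => propext ⟨fun h => h.of_iso htu, fun h => h.of_iso htu.symm⟩
  refine fun c hc => ?_
  obtain ⟨d, hd, hdc⟩ := List.mem_map.1 (hperm.mem_iff.2 (List.mem_map_of_mem hc))
  exact hdc.mp (hp d hd)

end Position

theorem Iso.ranks_eq {p q : Position} (h : Iso p q) : p.ranks = q.ranks :=
  Multiset.coe_eq_coe.2 (h.map_edges_perm fun _ _ _ _ => rfl)

theorem Position.ranks_addEdges_lt {s s' : Player} {A : Formula} {t : Position}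
    {Γ Γ' cs : List (Formula × Position)} (hΓ : Γ'.Sublist Γ)
    (hcs : ∀ c ∈ cs, c.1.rank < A.rank) :
    ((node s Γ').addEdges cs).ranks.IsDershowitzMannaLT (node s' ((A, t) :: Γ)).ranks := by
  have hle : ((Γ'.map fun c => c.1.rank : List Ordinal.{0}) : Multiset Ordinal.{0}) ≤
      (Γ.map fun c => c.1.rank : List Ordinal.{0}) :=
    Multiset.coe_le.2 (hΓ.map _).subperm
  simpa [ranks, edges, addEdges] using isDershowitzMannaLT_add_cons hle
    (Y := (cs.map fun c => c.1.rank : List Ordinal.{0})) (a := A.rank)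
    (by simpa only [Multiset.mem_coe, List.forall_mem_map] using hcs)

theorem BasicMove.exists_residuals {p q : Position} (h : BasicMove p q) :
    ∃ (s : Player) (A : Formula) (t : Position) (Γ cs : List (Formula × Position)),
      p = .node s ((A, t) :: Γ) ∧ q = t.addEdges cs ∧ A.Residuals (cs.map Prod.fst) ∧
      ∀ c ∈ cs, ∃ Γ' : List (Formula × Position), Γ'.Sublist Γ ∧ c.2 = .node s Γ' := by
  cases h with
  | negative s s' Γ Δ A hA =>
    exact ⟨s, A, .node s' Δ, Γ, [(A.dual, .node s Γ)], rfl, rfl, .negative hA, by simp⟩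
  | one s s' Δ => exact ⟨s, .one, .node s' Δ, [], [], rfl, rfl, .one, by simp⟩
  | tensor s s' Γ Γ' Θ Δ A B =>
    have hleft : (Γ ++ Θ).Sublist (Γ ++ Θ ++ Γ') := List.sublist_append_left _ _
    have hright : (Θ ++ Γ').Sublist (Γ ++ Θ ++ Γ') :=
      List.append_assoc Γ Θ Γ' ▸ List.sublist_append_right _ _
    refine ⟨s, .tensor A B, .node s' Δ, Γ ++ Θ ++ Γ',
      [(A.dual, .node s (Γ ++ Θ)), (B.dual, .node s (Θ ++ Γ'))], rfl, rfl, .tensor A B, ?_⟩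
    simp only [List.forall_mem_cons]
    exact ⟨⟨_, hleft, rfl⟩, ⟨_, hright, rfl⟩, by simp⟩
  | plusLeft s s' Γ Δ A B =>
    exact ⟨s, .plus A B, .node s' Δ, Γ, [(A.dual, .node s Γ)], rfl, rfl, .plusLeft A B, by simp⟩
  | plusRight s s' Γ Δ A B =>
    exact ⟨s, .plus A B, .node s' Δ, Γ, [(B.dual, .node s Γ)], rfl, rfl, .plusRight A B, by simp⟩
  | whynot s s' Γ Δ C n =>
    exact ⟨s, .whynot C, .node s' Δ, Γ, [(C.dual.tensorPow n, .node s Γ)], rfl, rfl, .whynot C n,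
      by simp⟩

namespace Position

theorem ReducibleEdges.terminating {p : Position} (hp : p.ReducibleEdges) : Terminating p := by
  induction hM : p.ranks using
    (Multiset.wellFounded_isDershowitzMannaLT (α := Ordinal.{0})).induction generalizing p with
  | _ M ih =>
  refine Acc.intro p ?_
  rintro q ⟨p', q', hpp', hmove, hq'q⟩
  refine Terminating.of_iso ?_ hq'q
  obtain ⟨s, A, t, Γ, cs, rfl, rfl, hres, hcs⟩ := hmove.exists_residuals
  obtain ⟨ht, hΓ⟩ := List.forall_mem_cons.1 (hp.of_iso hpp')
  rw [Reducible] at ht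
  refine ht cs hres fun c hc => ?_
  obtain ⟨Γ', hΓ', hc'⟩ := hcs c hc
  have hcA : c.1.rank < A.rank :=
    Formula.ResidualOf.rank_lt ⟨_, hres, List.mem_map_of_mem hc⟩
  -- When this vertex is active again, residuals of residuals of `A` have replaced the edge `A`.
  rw [hc', Reducible]
  intro ds hds hdsred
  have hdsA : ∀ d ∈ ds, d.1.rank < A.rank := fun d hd =>
    (Formula.ResidualOf.rank_lt ⟨_, hds, List.mem_map_of_mem hd⟩).trans hcA
  have hΓ'red : (node s Γ').ReducibleEdges := fun d hd => hΓ d (hΓ'.subset hd)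
  refine ih _ ?_ (hΓ'red.addEdges hdsred) rfl
  rw [← hM, hpp'.ranks_eq]
  exact ranks_addEdges_lt hΓ' hdsA

theorem ReducibleEdges.reducible {t : Position} (ht : t.ReducibleEdges) (A : Formula) :
    Reducible A t := by
  rw [Reducible]
  exact fun cs _ hcs => (ht.addEdges hcs).terminating

theorem reducibleEdges (t : Position) : t.ReducibleEdges := by
  induction t with
  | node _ cs ih => exact fun c hc => (ih c hc).reducible c.1

end Position

theorem wellFounded_move : WellFounded fun q p => Move p q :=
  ⟨fun p => p.reducibleEdges.terminating⟩

theorem exists_mem_forall_move_append_notMem (p : Position) {C : Set (List Position)}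
    (hC : C.Nonempty) :
    ∃ π ∈ C, ∀ q, Move (final p π) q → π ++ [q] ∉ C := by
  obtain ⟨_, ⟨π, hπ, rfl⟩, hmin⟩ := wellFounded_move.has_min (final p '' C) (hC.image _)
  refine ⟨π, hπ, fun q hq hπq => hmin q ⟨_, hπq, ?_⟩ hq⟩
  simp [final]

namespace Position

/-- Rename the signs of the vertices. -/
def mapSign (f : Player → Player) : Position → Position
  | node s cs => node (f s) (cs.map fun c => (c.1, c.2.mapSign f))
decreasing_by exact sizeOf_lt_of_mem ‹_›

theorem mapSign_node (f : Player → Player) (s : Player) (cs : List (Formula × Position)) :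
    (node s cs).mapSign f = node (f s) (cs.map (Prod.map id (mapSign f))) := by
  rw [mapSign]
  rfl

theorem mapSign_connect (f : Player → Player) (U : Position) (A : Formula) (V : Position) :
    (connect U A V).mapSign f = connect (U.mapSign f) A (V.mapSign f) := by
  cases U
  simp [connect, mapSign_node]

theorem leftInverse_mapSign {f g : Player → Player} (h : Function.LeftInverse g f) :
    Function.LeftInverse (mapSign g) (mapSign f) := by
  intro t
  induction t with
  | node s cs ih =>
    have hcs : (cs.map (Prod.map id (mapSign f))).map (Prod.map id (mapSign g)) = cs := by
      rw [List.map_map]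
      conv_rhs => rw [← List.map_id cs]
      exact List.map_congr_left fun c hc => Prod.ext rfl (ih c hc)
    rw [mapSign_node, mapSign_node, h, hcs]

theorem holder_mapSign (f : Player → Player) (t : Position) :
    (t.mapSign f).holder = f t.holder := by
  cases t
  rw [mapSign_node, holder, holder]

end Position

section MapSign

variable (f : Player → Player)

theorem Iso.mapSign {t u : Position} (h : Iso t u) : Iso (t.mapSign f) (u.mapSign f) := by
  induction h with
  | refl t => exact .refl _
  | symm _ ih => exact ih.symm
  | trans _ _ ih₁ ih₂ => exact ih₁.trans ih₂
  | perm s h => simpa only [Position.mapSign_node] using Iso.perm (f s) (h.map _)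
  | congr s A cs _ ih => simpa [Position.mapSign_node] using Iso.congr (f s) A _ ih

theorem BasicMove.mapSign {p q : Position} (h : BasicMove p q) :
    BasicMove (p.mapSign f) (q.mapSign f) := by
  cases h <;>
    simp only [Position.mapSign_node, List.map_cons, List.map_append, List.map_nil, Prod.map_apply,
      id]
  case negative hA => exact .negative _ _ _ _ _ hA
  case one => exact .one _ _ _
  case tensor hΘ =>
    refine .tensor _ _ _ _ _ _ _ _ fun c hc => ?_
    obtain ⟨d, hd, rfl⟩ := List.mem_map.1 hc
    exact hΘ d hd
  case plusLeft => exact .plusLeft _ _ _ _ _ _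
  case plusRight => exact .plusRight _ _ _ _ _ _
  case whynot => exact .whynot _ _ _ _ _ _

theorem Move.mapSign {p q : Position} (h : Move p q) : Move (p.mapSign f) (q.mapSign f) := by
  obtain ⟨p', q', h₁, h₂, h₃⟩ := h
  exact ⟨_, _, h₁.mapSign f, h₂.mapSign f, h₃.mapSign f⟩

theorem AllSigned.mapSign {s : Player} {t : Position} (h : AllSigned s t) :
    AllSigned (f s) (t.mapSign f) := by
  induction h with
  | node cs _ ih =>
    rw [Position.mapSign_node]
    refine .node _ fun c hc => ?_
    obtain ⟨d, hd, rfl⟩ := List.mem_map.1 hc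
    exact ih d hd

theorem final_map_mapSign (p : Position) (π : List Position) :
    final (p.mapSign f) (π.map (Position.mapSign f)) = (final p π).mapSign f := by
  cases π using List.reverseRecOn <;> simp [final]

end MapSign

/-- The other player. -/
def Player.swap : Player → Player
  | proponent => opponent
  | opponent => proponent

theorem Player.swap_involutive : Function.Involutive Player.swap :=
  fun s => by cases s <;> rfl

theorem displace_connect (U : Position) (A : Formula) (V : Position) :
    Displace (connect U A V) (connect V A.dual U) := by
  obtain ⟨s, cs⟩ := U
  obtain ⟨s', ds⟩ := V
  exact .step s s' [] cs ds A

theorem IsPlay.move_final {p q : Position} {π : List Position} (h : IsPlay p (π ++ [q])) :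
    Move (final p π) q := by
  rw [IsPlay, ← List.cons_append, List.isChain_append] at h
  exact h.2.2 _ (by simp [final, List.getLast?_cons, List.getLastD_eq_getLast?]) q (by simp)

theorem IsWinningStrategy.exists_append_mem {p : Position} {S : Set (List Position)}
    (hS : IsWinningStrategy p S) {π : List Position} (hπ : π ∈ S)
    (hp : (final p π).holder = .proponent) : ∃ q, π ++ [q] ∈ S := by
  by_contra! hext
  have hmax : IsMaximalIn S π := by
    refine ⟨hπ, ?_⟩
    rintro _ hρ ⟨_ | ⟨q, ρ⟩, rfl⟩
    · exact List.append_nil π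
    · exact absurd (hS.1.mem_of_isPrefix _ hρ _ ⟨ρ, by simp⟩) (hext q)
  exact Player.noConfusion (hp.symm.trans (hS.2 π hmax))

theorem IsWinningStrategy.not_isWinningStrategy_mapSign_swap {p : Position}
    {S T : Set (List Position)} (hS : IsWinningStrategy p S) :
    ¬IsWinningStrategy (p.mapSign Player.swap) T := by
  intro hT
  let σ := Position.mapSign Player.swap
  have hσ : Function.Involutive σ := Position.leftInverse_mapSign Player.swap_involutive
  obtain ⟨π, ⟨hπS, hπT⟩, hstuck⟩ := exists_mem_forall_move_append_notMem p
    (C := {π | π ∈ S ∧ π.map σ ∈ T}) ⟨[], hS.1.nil_mem, hT.1.nil_mem⟩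
  have hfinal : final (σ p) (π.map σ) = σ (final p π) := final_map_mapSign _ p π
  have hholder : (final (σ p) (π.map σ)).holder = (final p π).holder.swap := by
    rw [hfinal, Position.holder_mapSign]
  suffices ∃ q, Move (final p π) q ∧ π ++ [q] ∈ S ∧ π.map σ ++ [σ q] ∈ T by
    obtain ⟨q, hmove, hqS, hqT⟩ := this
    exact hstuck q hmove ⟨hqS, by rwa [List.map_append]⟩
  cases hp : (final p π).holder with
  | proponent =>
    obtain ⟨q, hq⟩ := hS.exists_append_mem hπS hp
    have hmove : Move (final p π) q := (hS.1.isPlay _ hq).move_final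
    exact ⟨q, hmove, hq,
      hT.1.welcoming _ hπT (by rw [hholder, hp, Player.swap]) _ (hfinal ▸ hmove.mapSign _)⟩
  | opponent =>
    obtain ⟨r, hr⟩ := hT.exists_append_mem hπT (by rw [hholder, hp, Player.swap])
    have hmove : Move (final p π) (σ r) := by
      have hmove' := ((hT.1.isPlay _ hr).move_final).mapSign Player.swap
      exact hσ (final p π) ▸ hfinal ▸ hmove'
    exact ⟨σ r, hmove, hS.1.welcoming _ hπS hp _ hmove, (hσ r).symm ▸ hr⟩

theorem not_valid_and_valid_dual (A : Formula) : ¬(Valid A ∧ Valid A.dual) := by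
  rintro ⟨⟨U, hU, hUwin⟩, ⟨V, hV, hVwin⟩⟩
  let σ := Position.mapSign Player.swap
  obtain ⟨S, hS⟩ := hUwin (σ V) (hV.mapSign Player.swap) _ .refl
  have hswap : SameTree (connect V A.dual (σ U)) (σ (connect U A (σ V))) := by
    have hV' : σ (σ V) = V := Position.leftInverse_mapSign Player.swap_involutive V
    have hconnect : σ (connect U A (σ V)) = connect (σ U) A V :=
      (Position.mapSign_connect _ U A (σ V)).trans (congrArg _ hV')
    have hdisp : Displace (connect V A.dual (σ U)) (connect (σ U) A.dual.dual V) :=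
      displace_connect V A.dual (σ U)
    rw [hconnect]
    exact .single (by rwa [Formula.dual_dual] at hdisp)
  obtain ⟨T, hT⟩ := hVwin (σ U) (hU.mapSign Player.swap) _ hswap
  exact hS.not_isWinningStrategy_mapSign_swap hT

end GLLTN

theorem mainTheorem4 :
    (∀ A : GLLTN.Formula, ¬ (GLLTN.Valid A ∧ GLLTN.Valid A.dual)) ∧
    (∀ A : GLLTN.Formula, ¬ (GLLTN.Provable [A] ∧ GLLTN.Provable [A.dual])) :=
  ⟨GLLTN.not_valid_and_valid_dual, GLLTN.not_provable_and_provable_dual⟩
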